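/- Let $\mathcal H$ be a complex Hilbert space, $\mathbb B(\mathcal H)$ the algebra of bounded linear operators on $\mathcal H$, and for an operator $Y$ write $|Y|=(Y^*Y)^{1/2}$, $\|Y\|$ for the operator norm, and $w(Y)=\sup_{\|z\|=1}|\langle Yz,z\rangle|$ for the numerical radius. For $\rho>0$, an operator $Y\in\mathbb B(\mathcal H)$ is a $\rho$-contraction if there are a Hilbert space $\mathcal K\supseteq\mathcal H$ and a unitary operator $U$ on $\mathcal K$ such that $Y^nx=\rho PU^nx$ for all $x\in\mathcal H$ and $n=1,2,\dots$, where $P$ is the orthogonal projection of $\mathcal K$ onto $\mathcal H$; put $$w_\rho(Y)=\inf\{t>0:\ t^{-1}Y\ \text{is a }\rho\text{-contraction}\}.$$ Let $\rho\in(0,2]$, $\nu\in[0,1]$, $\alpha=\sqrt{8\rho^{-1}-4}$ and $\beta=2\rho^{-1}-2$. For $X\in\mathbb B(\mathcal H)$ let $$\Delta_{(\rho,\nu)}(X)=w\left(\begin{bmatrix}0&\alpha X\\ \alpha(1-2\nu)X^*&\beta\left(X+(1-2\nu)X^*\right)\end{bmatrix}\right),$$ where the operator matrix acts on $\mathcal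 H\oplus\mathcal H$. Then, for every $X\in\mathbb B(\mathcal H)$, $$\Delta_{(\rho,\nu)}^2(X)\le(1-2\nu)^2w_\rho^2(X)+\left|(1-2\nu)\beta\right|w_\rho(X^2)+\frac{|1-2\nu|+1}{2}\left\|\begin{bmatrix}\mathbf A&\mathbf B\\ \mathbf B&\mathbf C\end{bmatrix}\right\|,$$ where $\mathbf A=\alpha^2|X^*|^2$, $\mathbf B=\alpha\beta|X^*|^2$ and $\mathbf C=(\alpha^2+\beta^2)|X|^2+\beta^2|X^*|^2$. -/

import Mathlib

open scoped InnerProductSpace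

universe u

noncomputable section

namespace OperatorRadius

/-- The Hilbert space direct sum `H ⊕ H`, with the inner product
`⟪(x, y), (x', y')⟫ = ⟪x, x'⟫ + ⟪y, y'⟫`. -/
abbrev Double (H : Type u) : Type u := WithLp 2 (H × H)

variable {H : Type u} [NormedAddCommGroup H] [InnerProductSpace ℂ H]

/-- The operator matrix with first row `S, X` and second row `Y, T`, acting on `H ⊕ H`. -/
def blockOp (S X Y T : H →L[ℂ] H) : Double H →L[ℂ] Double H :=
  ((WithLp.prodContinuousLinearEquiv 2 ℂ H H).symm : H × H →L[ℂ] Double H) ∘L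
    ((S.coprod X).prod (Y.coprod T)) ∘L
      ((WithLp.prodContinuousLinearEquiv 2 ℂ H H) : Double H →L[ℂ] H × H)

theorem blockOp_apply (S X Y T : H →L[ℂ] H) (z : Double H) :
    blockOp S X Y T z = WithLp.toLp 2 (S z.fst + X z.snd, Y z.fst + T z.snd) := rfl

/-- The numerical radius `w(X) = sup {|⟨X z, z⟩| : ‖z‖ = 1}`; the set is bounded by `‖X‖`, and the
value is `0` on the zero space. -/
def numericalRadius (X : H →L[ℂ] H) : ℝ :=
  sSup {r : ℝ | ∃ z : H, ‖z‖ = 1 ∧ r = ‖⟪X z, z⟫_ℂ‖}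

variable [CompleteSpace H]

/-- `X` is a `ρ`-contraction: there are a Hilbert space `K`, containing `H` through a linear
isometry `J`, and a unitary operator `U` on `K` such that `Xⁿ x = ρ P Uⁿ x` for all `x ∈ H` and
`n ≥ 1`. Here `P`, the orthogonal projection of `K` onto the copy of `H`, read as a map to `H`, is
the adjoint of `J`. -/
def IsRhoContraction (ρ : ℝ) (X : H →L[ℂ] H) : Prop :=
  ∃ (K : Type u) (_ : NormedAddCommGroup K) (_ : InnerProductSpace ℂ K) (_ : CompleteSpace K)
    (J : H →ₗᵢ[ℂ] K) (U : K →L[ℂ] K), U ∈ unitary (K →L[ℂ] K) ∧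
      ∀ n : ℕ, 1 ≤ n → ∀ x : H,
        (X ^ n) x =
          (ρ : ℂ) • ContinuousLinearMap.adjoint J.toContinuousLinearMap ((U ^ n) (J x))

/-- The operator radius `w_ρ(X) = inf {t > 0 : t⁻¹ X is a ρ-contraction}`. -/
def rhoRadius (ρ : ℝ) (X : H →L[ℂ] H) : ℝ :=
  sInf {t : ℝ | 0 < t ∧ IsRhoContraction ρ (((t⁻¹ : ℝ) : ℂ) • X)}

/-- The constant `α = √(8ρ⁻¹ - 4)`. -/
def alpha (ρ : ℝ) : ℝ := √(8 * ρ⁻¹ - 4)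

/-- The constant `β = 2ρ⁻¹ - 2`. -/
def beta (ρ : ℝ) : ℝ := 2 * ρ⁻¹ - 2

/-- `Δ_(ρ,ν)(X)`, the numerical radius of the operator matrix with first row `0, αX` and second
row `α(1-2ν)X*, β(X + (1-2ν)X*)`. -/
def Delta (ρ ν : ℝ) (X : H →L[ℂ] H) : ℝ :=
  numericalRadius (blockOp 0 ((alpha ρ : ℂ) • X)
    (((alpha ρ * (1 - 2 * ν) : ℝ) : ℂ) • star X)
    ((beta ρ : ℂ) • (X + ((1 - 2 * ν : ℝ) : ℂ) • star X)))

/-- `A = α² |X*|²`, where `|Y| = (Y*Y)^(1/2)`. -/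
def blockA (ρ : ℝ) (X : H →L[ℂ] H) : H →L[ℂ] H :=
  ((alpha ρ ^ 2 : ℝ) : ℂ) • CFC.abs (star X) ^ 2

/-- `B = αβ |X*|²`. -/
def blockB (ρ : ℝ) (X : H →L[ℂ] H) : H →L[ℂ] H :=
  ((alpha ρ * beta ρ : ℝ) : ℂ) • CFC.abs (star X) ^ 2

/-- `C = (α² + β²) |X|² + β² |X*|²`. -/
def blockC (ρ : ℝ) (X : H →L[ℂ] H) : H →L[ℂ] H :=
  ((alpha ρ ^ 2 + beta ρ ^ 2 : ℝ) : ℂ) • CFC.abs X ^ 2 +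
    ((beta ρ ^ 2 : ℝ) : ℂ) • CFC.abs (star X) ^ 2

end OperatorRadius

end

/-! Put `c = 1 - 2ν` and let `T` have rows `0, αX` and `0, βX`. The matrix defining `Delta` is `T +
c T*`; moreover `T T* + T* T` is the matrix of `A, B, C`, and `T²` is `β` times the matrix `T` built
from `X²`. Two facts suffice.

For a unit vector `z`, `norm_inner_add_smul_star_sq_le` bounds `|⟨(T + c T*)z, z⟩|²` through `|⟨Tz,
z⟩|`, `|⟨T²z, z⟩|` and `‖T T* + T* T‖`, by Buzano's inequality.

The numerical radius of `T` is at most `w_ρ(X)` (`norm_inner_blockOp_le_rhoRadius`). Indeed, for a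
unitary `U` the operator `(1 + zU)(1 - zU)⁻¹` has nonnegative real part when `|z| < 1`; compressing
it to `H` gives a quadratic inequality for each `ρ`-contraction, and the mixed term of `⟨Tz, z⟩` is
absorbed by AM-GM. -/

open Filter Topology

noncomputable section

namespace OperatorRadius

/-! ### Bilateral shift on `ℓ²(ℤ, E)` -/

section Dilation

variable {E : Type u} [NormedAddCommGroup E] [InnerProductSpace ℂ E]

/-- The bilateral shift `f ↦ f (· + d)` on `ℓ²(ℤ, E)`, for a fixed `d : ℤ`. -/
def shiftEquiv (E : Type u) [NormedAddCommGroup E] [InnerProductSpace ℂ E] (d : ℤ) :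
    lp (fun _ : ℤ => E) 2 ≃ₗᵢ[ℂ] lp (fun _ : ℤ => E) 2 :=
  have mem (e : ℤ) (f : lp (fun _ : ℤ => E) 2) : Memℓp (fun k => f (k + e)) 2 := by
    refine memℓp_gen ?_
    exact (Equiv.addRight e).summable_iff.mpr ((lp.memℓp f).summable (by norm_num))
  LinearEquiv.isometryOfInner
    { toFun := fun f => ⟨fun k => f (k + d), mem d f⟩
      invFun := fun f => ⟨fun k => f (k + -d), mem (-d) f⟩
      map_add' := fun _ _ => rfl
      map_smul' := fun _ _ => rfl
      left_inv := fun f => by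
        ext k
        simp
      right_inv := fun f => by
        ext k
        simp }
    fun f g => (Equiv.addRight d).tsum_eq fun k => ⟪f k, g k⟫_ℂ

/-- A sequence of operators with `∑ₖ Gₖ* Gₖ = 1` weakly embeds `H` isometrically into `ℓ²(ℤ, E)`,
with support in the nonnegative indices. -/
theorem exists_isometry_lp_int {H : Type u} [NormedAddCommGroup H] [InnerProductSpace ℂ H]
    (G : ℕ → H →L[ℂ] E) (hG : ∀ x y, HasSum (fun k => ⟪G k x, G k y⟫_ℂ) ⟪x, y⟫_ℂ) :
    ∃ J : H →ₗᵢ[ℂ] lp (fun _ : ℤ => E) 2,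
      (∀ x, ∀ k : ℕ, J x k = G k x) ∧ ∀ x, ∀ k : ℤ, k < 0 → J x k = 0 := by
  let g (x : H) (k : ℤ) : E := if k < 0 then 0 else G k.toNat x
  have gnat (x : H) (k : ℕ) : g x k = G k x := by simp [g]
  have gneg (x : H) (k : ℤ) (hk : k < 0) : g x k = 0 := by simp [g, hk]
  have out (x : H) (k : ℤ) (hk : k ∉ Set.range (Nat.cast : ℕ → ℤ)) : g x k = 0 := by
    refine gneg x k ?_
    by_contra! h
    exact hk ⟨k.toNat, Int.toNat_of_nonneg h⟩
  have mem (x : H) : Memℓp (E := fun _ : ℤ => E) (g x) 2 := by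
    refine memℓp_gen ?_
    have h := (Complex.reCLM.hasSum (hG x x)).summable
    rw [← Nat.cast_injective.summable_iff (f := fun k : ℤ => ‖g x k‖ ^ (2 : ENNReal).toReal)]
    · refine h.congr fun k => ?_
      have := inner_self_eq_norm_sq (𝕜 := ℂ) (G k x)
      simpa [gnat] using this
    · intro k hk
      simp [out x k hk]
  let J₀ : H →ₗ[ℂ] lp (fun _ : ℤ => E) 2 :=
    { toFun := fun x => ⟨g x, mem x⟩
      map_add' := fun x y => by
        ext k
        change g (x + y) k = g x k + g y k
        by_cases hk : k < 0 <;> simp [g, hk]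
      map_smul' := fun c x => by
        ext k
        change g (c • x) k = c • g x k
        by_cases hk : k < 0 <;> simp [g, hk] }
  refine ⟨J₀.isometryOfInner fun x y => ?_, gnat, gneg⟩
  refine (lp.hasSum_inner (𝕜 := ℂ) (J₀ x) (J₀ y)).unique ?_
  rw [← Nat.cast_injective.hasSum_iff]
  · convert! hG x y using 2 with k
  · intro k hk
    have : J₀ x k = 0 := out x k hk
    simp [this]

end Dilation

/-! ### Operator matrices and Buzano's inequality -/

section InnerProduct

variable {H : Type u} [NormedAddCommGroup H] [InnerProductSpace ℂ H]

theorem inner_blockOp (S X Y T : H →L[ℂ] H) (z w : Double H) :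
    ⟪blockOp S X Y T z, w⟫_ℂ =
      ⟪S z.fst + X z.snd, w.fst⟫_ℂ + ⟪Y z.fst + T z.snd, w.snd⟫_ℂ := rfl

theorem blockOp_add (S X Y T S' X' Y' T' : H →L[ℂ] H) :
    blockOp S X Y T + blockOp S' X' Y' T' = blockOp (S + S') (X + X') (Y + Y') (T + T') := by
  ext z : 1
  refine WithLp.ofLp_injective 2 (Prod.ext ?_ ?_)
  · exact add_add_add_comm (S z.fst) (X z.snd) (S' z.fst) (X' z.snd)
  · exact add_add_add_comm (Y z.fst) (T z.snd) (Y' z.fst) (T' z.snd)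

theorem smul_blockOp (c : ℂ) (S X Y T : H →L[ℂ] H) :
    c • blockOp S X Y T = blockOp (c • S) (c • X) (c • Y) (c • T) := by
  ext z : 1
  refine WithLp.ofLp_injective 2 (Prod.ext ?_ ?_)
  · exact smul_add c (S z.fst) (X z.snd)
  · exact smul_add c (Y z.fst) (T z.snd)

theorem blockOp_mul (S X Y T S' X' Y' T' : H →L[ℂ] H) :
    blockOp S X Y T * blockOp S' X' Y' T' =
      blockOp (S * S' + X * Y') (S * X' + X * T') (Y * S' + T * Y') (Y * X' + T * T') := by
  have entry (A B A' B' C' D' : H →L[ℂ] H) (x y : H) :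
      A (A' x + B' y) + B (C' x + D' y) = (A * A' + B * C') x + (A * B' + B * D') y := by
    simp only [map_add, add_apply, mul_apply_eq_comp]
    abel
  ext z : 1
  exact WithLp.ofLp_injective 2 (Prod.ext (entry S X S' X' Y' T' z.fst z.snd)
    (entry Y T S' X' Y' T' z.fst z.snd))

/-- Buzano's inequality. -/
theorem norm_inner_mul_inner_le {e : H} (he : ‖e‖ = 1) (a b : H) :
    ‖⟪a, e⟫_ℂ‖ * ‖⟪e, b⟫_ℂ‖ ≤ (‖a‖ * ‖b‖ + ‖⟪a, b⟫_ℂ‖) / 2 := by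
  set p := ⟪e, b⟫_ℂ with hp
  -- The map `R b = 2⟪e, b⟫e - b` is a reflection, hence isometric. The inequality is Cauchy–Schwarz
  -- applied to `⟪a, R b⟫ = 2⟪a, e⟫⟪e, b⟫ - ⟪a, b⟫`.
  have hrefl : ‖(2 * p) • e - b‖ = ‖b‖ := by
    have h := norm_sub_sq (𝕜 := ℂ) ((2 * p) • e) b
    have h1 : RCLike.re ⟪(2 * p) • e, b⟫_ℂ = 2 * ‖p‖ ^ 2 := by
      have : ⟪(2 * p) • e, b⟫_ℂ = ((2 * ‖p‖ ^ 2 : ℝ) : ℂ) := by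
        rw [inner_smul_left, ← hp, map_mul (starRingEnd ℂ), mul_assoc, Complex.conj_mul',
          Complex.conj_ofNat]
        push_cast
        rfl
      rw [this]
      exact Complex.ofReal_re _
    rw [h1, norm_smul, norm_mul, he, RCLike.norm_ofNat] at h
    exact (sq_eq_sq₀ (norm_nonneg _) (norm_nonneg _)).mp (by linarith)
  have h1 : ⟪a, (2 * p) • e - b⟫_ℂ + ⟪a, b⟫_ℂ = 2 * (⟪a, e⟫_ℂ * p) := by
    rw [inner_sub_right, inner_smul_right]
    ring
  have h2 := norm_add_le ⟪a, (2 * p) • e - b⟫_ℂ ⟪a, b⟫_ℂ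
  have h3 := norm_inner_le_norm (𝕜 := ℂ) a ((2 * p) • e - b)
  rw [h1, norm_mul, norm_mul, RCLike.norm_ofNat] at h2
  rw [hrefl] at h3
  linarith

end InnerProduct

/-! ### Existence of `ρ`-contractions -/

variable {H : Type u} [NormedAddCommGroup H] [InnerProductSpace ℂ H] [CompleteSpace H]

/-- Correlations of a sequence of operators against the bilateral shift give `ρ`-contractions. -/
theorem isRhoContraction_of_hasSum {E : Type u} [NormedAddCommGroup E] [InnerProductSpace ℂ E]
    [CompleteSpace E] {ρ : ℝ} (hρ : ρ ≠ 0) (Y : H →L[ℂ] H) (G : ℕ → H →L[ℂ] E)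
    (h₀ : ∀ x y, HasSum (fun k => ⟪G k x, G k y⟫_ℂ) ⟪x, y⟫_ℂ)
    (h : ∀ n, 1 ≤ n → ∀ x y,
      HasSum (fun k => ⟪G (k + n) x, G k y⟫_ℂ) (((ρ⁻¹ : ℝ) : ℂ) * ⟪(Y ^ n) x, y⟫_ℂ)) :
    IsRhoContraction ρ Y := by
  obtain ⟨J, hJ, hJneg⟩ := exists_isometry_lp_int G h₀
  let U : lp (fun _ : ℤ => E) 2 →L[ℂ] lp (fun _ : ℤ => E) 2 := shiftEquiv E 1
  have hU (n : ℕ) (f : lp (fun _ : ℤ => E) 2) (k : ℤ) : (U ^ n) f k = f (k + n) := by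
    induction n generalizing k with
    | zero => simp
    | succ n ih =>
      rw [pow_succ']
      change (U ^ n) f (k + 1) = _
      rw [ih, add_assoc, add_comm (1 : ℤ), Nat.cast_succ]
  refine ⟨lp (fun _ : ℤ => E) 2, inferInstance, inferInstance, inferInstance, J, U,
    (Unitary.linearIsometryEquiv.symm (shiftEquiv E 1)).2, fun n hn x => ?_⟩
  refine ext_inner_right ℂ fun y => ?_
  rw [inner_smul_left, ContinuousLinearMap.adjoint_inner_left]
  have key : ⟪(U ^ n) (J x), J y⟫_ℂ = ((ρ⁻¹ : ℝ) : ℂ) * ⟪(Y ^ n) x, y⟫_ℂ := by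
    refine (lp.hasSum_inner (𝕜 := ℂ) _ _).unique ?_
    rw [← Nat.cast_injective.hasSum_iff]
    · convert! h n hn x y using 2 with k
      have e := hJ x (k + n)
      push_cast at e
      simp only [Function.comp, hU, hJ, e]
    · intro k hk
      have : J y k = 0 := by
        refine hJneg y k ?_
        by_contra! h
        exact hk ⟨k.toNat, Int.toNat_of_nonneg h⟩
      simp [this]
  change _ = _ * ⟪(U ^ n) (J x), J y⟫_ℂ
  rw [key]
  simp [hρ]

/-- A square root `F` of the positive operator `a - c Y* Y`. -/
theorem exists_sqrt_defect {a c : ℝ} (Y : H →L[ℂ] H) (h : c * ‖Y‖ ^ 2 ≤ a) (hc : 0 ≤ c) :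
    ∃ F : H →L[ℂ] H, ∀ x y, ⟪F x, F y⟫_ℂ = a * ⟪x, y⟫_ℂ - c * ⟪Y x, Y y⟫_ℂ := by
  let D : H →L[ℂ] H := (a : ℂ) • 1 - (c : ℂ) • (star Y * Y)
  have hD (x y : H) : ⟪D x, y⟫_ℂ = a * ⟪x, y⟫_ℂ - c * ⟪Y x, Y y⟫_ℂ := by
    simp [D, ContinuousLinearMap.star_eq_adjoint,
      ContinuousLinearMap.adjoint_inner_left]
  have hDs (x y : H) : ⟪x, D y⟫_ℂ = a * ⟪x, y⟫_ℂ - c * ⟪Y x, Y y⟫_ℂ := by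
    simp [D, ContinuousLinearMap.star_eq_adjoint,
      ContinuousLinearMap.adjoint_inner_right]
  have hpos : 0 ≤ D := by
    rw [ContinuousLinearMap.nonneg_iff_isPositive, ContinuousLinearMap.isPositive_def]
    refine ⟨fun x y => (hD x y).trans (hDs x y).symm, fun x => ?_⟩
    have hx : ‖Y x‖ ^ 2 ≤ ‖Y‖ ^ 2 * ‖x‖ ^ 2 := by
      rw [← mul_pow]
      gcongr
      exact Y.le_opNorm x
    have h1 := mul_le_mul_of_nonneg_left hx hc
    have h2 := mul_le_mul_of_nonneg_right h (sq_nonneg ‖x‖)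
    rw [ContinuousLinearMap.reApplyInnerSelf_apply, hD,
      inner_self_eq_norm_sq_to_K, inner_self_eq_norm_sq_to_K]
    have : (a * (‖x‖ : ℂ) ^ 2 - c * (‖Y x‖ : ℂ) ^ 2) =
        ((a * ‖x‖ ^ 2 - c * ‖Y x‖ ^ 2 : ℝ) : ℂ) := by push_cast; rfl
    refine le_of_le_of_eq ?_ (congrArg Complex.re this).symm
    rw [Complex.ofReal_re]
    linarith
  refine ⟨CFC.sqrt D, fun x y => ?_⟩
  have hsa : star (CFC.sqrt D) = CFC.sqrt D := (CFC.sqrt_nonneg D).isSelfAdjoint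
  rw [← hD, ← ContinuousLinearMap.adjoint_inner_left, ← ContinuousLinearMap.star_eq_adjoint, hsa,
    ← mul_apply_eq_comp, CFC.sqrt_mul_sqrt_self D hpos]

/-- Operators of small norm are `ρ`-contractions: the dilation is the bilateral shift, with `x`
embedded as the sequence `(aₖ Yᵏ x, F Yᵏ x)`, `k ≥ 0`, where `a₀ = 1/2`, `aₖ = q = 2/ρ - 3/2` for
`k ≥ 1`, and `F² = 3/4 - (3/4 + q²) Y* Y`. -/
theorem isRhoContraction_of_norm_le {ρ : ℝ} (hρ : 0 < ρ) (Y : H →L[ℂ] H) (hY : ‖Y‖ < 1)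
    (h : (3 / 4 + (2 / ρ - 3 / 2) ^ 2) * ‖Y‖ ^ 2 ≤ 3 / 4) : IsRhoContraction ρ Y := by
  obtain ⟨F, hF⟩ := exists_sqrt_defect Y h (by positivity)
  set q : ℝ := 2 / ρ - 3 / 2 with hq
  let a (k : ℕ) : ℝ := if k = 0 then 1 / 2 else q
  have a0 : a 0 = 1 / 2 := rfl
  let G (k : ℕ) : H →L[ℂ] Double H :=
    ((WithLp.prodContinuousLinearEquiv 2 ℂ H H).symm : H × H →L[ℂ] Double H) ∘L
      (((a k : ℂ) • Y ^ k).prod (F * Y ^ k))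
  -- The value is `1` at `n = 0`; for `n ≥ 1` it is `3/4 + q/2`, and the choice of `q` makes this
  -- `1/ρ`.
  have corr (n : ℕ) (x y : H) : HasSum (fun k => ⟪G (k + n) x, G k y⟫_ℂ)
      ((3 / 4 + a n / 2) * ⟪(Y ^ n) x, y⟫_ℂ) := by
    let b (k : ℕ) : ℂ := ⟪(Y ^ (k + n)) x, (Y ^ k) y⟫_ℂ
    have hb : Summable b := by
      refine Summable.of_norm_bounded
        ((summable_geometric_of_lt_one (norm_nonneg Y) hY).mul_right (‖x‖ * ‖y‖)) fun k => ?_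
      have hpow (m : ℕ) (z : H) : ‖(Y ^ m) z‖ ≤ ‖Y‖ ^ m * ‖z‖ := by
        induction m with
        | zero => simp
        | succ m ih =>
          rw [pow_succ', pow_succ', mul_assoc]
          exact (Y.le_opNorm _).trans (mul_le_mul_of_nonneg_left ih (norm_nonneg _))
      have h1 : ‖(Y ^ (k + n)) x‖ ≤ ‖Y‖ ^ k * ‖x‖ := by
        refine (hpow _ _).trans ?_
        gcongr ?_ * _
        exact pow_le_pow_of_le_one (norm_nonneg Y) hY.le (Nat.le_add_right _ _)
      have h2 : ‖(Y ^ k) y‖ ≤ ‖y‖ := by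
        refine (hpow _ _).trans (mul_le_of_le_one_left (norm_nonneg y) ?_)
        exact pow_le_one₀ (norm_nonneg Y) hY.le
      calc ‖b k‖ ≤ ‖(Y ^ (k + n)) x‖ * ‖(Y ^ k) y‖ := norm_inner_le_norm _ _
        _ ≤ (‖Y‖ ^ k * ‖x‖) * ‖y‖ := by gcongr
        _ = _ := by ring
    have hs := hb.hasSum
    have hs' : HasSum (fun k => b (k + 1)) ((∑' k, b k) - b 0) := by
      simpa using (hasSum_nat_add_iff' 1).mpr hs
    -- For `k ≥ 1` the `k`-th term is `(3/4 + q²)(b k - b (k + 1))`, which telescopes; since `a 0 ≠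
    -- q` is possible, the term `k = 0` needs the correction `(a n / 2 - q²) b 0`.
    have hsum := ((hs.sub hs').mul_left ((3 / 4 + q ^ 2 : ℝ) : ℂ)).add
      (hasSum_ite_eq 0 (((a n / 2 - q ^ 2 : ℝ) : ℂ) * b 0))
    have hb0 : b 0 = ⟪(Y ^ n) x, y⟫_ℂ := by simp [b]
    rw [← hb0]
    convert! hsum using 1
    · funext k
      have hb1 : b (k + 1) = ⟪Y ((Y ^ (k + n)) x), Y ((Y ^ k) y)⟫_ℂ := by
        simp only [b]
        rw [show k + 1 + n = k + n + 1 by ring, pow_succ', pow_succ' Y k]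
        rfl
      have hG : ⟪G (k + n) x, G k y⟫_ℂ =
          (a (k + n) * a k : ℝ) * b k + ⟪F ((Y ^ (k + n)) x), F ((Y ^ k) y)⟫_ℂ := by
        change ⟪(a (k + n) : ℂ) • (Y ^ (k + n)) x, (a k : ℂ) • (Y ^ k) y⟫_ℂ +
          ⟪F ((Y ^ (k + n)) x), F ((Y ^ k) y)⟫_ℂ = _
        rw [inner_smul_left, inner_smul_right, Complex.conj_ofReal, Complex.ofReal_mul,
          mul_assoc]
      rw [hG, hF, ← hb1]
      change _ + (_ * b k - _) = _
      rcases Nat.eq_zero_or_pos k with rfl | hk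
      · simp only [zero_add, a0, if_true]
        push_cast
        ring
      · simp [a, hk.ne']
        ring
    · push_cast
      ring
  refine isRhoContraction_of_hasSum hρ.ne' Y G (fun x y => ?_) fun n hn x y => ?_
  · convert! corr 0 x y using 1
    simp [a]
    norm_num
  · convert! corr n x y using 1
    have : n ≠ 0 := by omega
    simp [a, this, hq]
    left
    ring

/-- The infimum defining `rhoRadius` runs over a nonempty set; over the empty set it would be `0`
and bound nothing from above. -/
theorem exists_isRhoContraction {ρ : ℝ} (hρ : 0 < ρ) (X : H →L[ℂ] H) :
    ∃ t : ℝ, 0 < t ∧ IsRhoContraction ρ (((t⁻¹ : ℝ) : ℂ) • X) := by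
  set c : ℝ := 3 / 4 + (2 / ρ - 3 / 2) ^ 2 with hc
  have hc0 : 3 / 4 ≤ c := by rw [hc]; nlinarith [sq_nonneg (2 / ρ - 3 / 2)]
  have ht : 0 < 2 * c * (‖X‖ + 1) := by positivity
  have hn : ‖(((2 * c * (‖X‖ + 1))⁻¹ : ℝ) : ℂ) • X‖ ≤ 1 / (2 * c) := by
    rw [norm_smul, Complex.norm_real, Real.norm_of_nonneg (by positivity), inv_mul_le_iff₀ ht]
    field_simp
    linarith [norm_nonneg X]
  have h1 : 1 / (2 * c) ≤ 2 / 3 := by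
    rw [div_le_div_iff₀ (by positivity) (by norm_num)]
    linarith
  refine ⟨_, ht, isRhoContraction_of_norm_le hρ _ (by linarith) ?_⟩
  rw [← hc]
  calc c * ‖(((2 * c * (‖X‖ + 1))⁻¹ : ℝ) : ℂ) • X‖ ^ 2 ≤ c * (1 / (2 * c)) ^ 2 := by gcongr
    _ = 1 / (2 * c) / 2 := by field_simp
    _ ≤ 3 / 4 := by linarith

/-! ### Quadratic inequalities for `ρ`-contractions -/

/-- With `v = x - zYx` and `u = (1 - zU)⁻¹Jv`, this is `Re⟪(1 + zU)u, (1 - zU)u⟫ = ‖u‖² - ‖zUu‖² ≥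
0` written in terms of `x`. The choice of `v` makes the compressed Neumann series telescope, so that
`Pu = v + ρ⁻¹zYx`. -/
theorem IsRhoContraction.disc_inequality {ρ : ℝ} (hρ : ρ ≠ 0) {Y : H →L[ℂ] H}
    (hY : IsRhoContraction ρ Y) (x : H) {z : ℂ} (hz : ‖z‖ < 1) :
    0 ≤ ‖x‖ ^ 2 + beta ρ * (⟪z • Y x, x⟫_ℂ).re - (2 * ρ⁻¹ - 1) * ‖z • Y x‖ ^ 2 := by
  obtain ⟨K, _, _, _, J, U, hU, h⟩ := hY
  set P := ContinuousLinearMap.adjoint J.toContinuousLinearMap with hP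
  have hUnorm (v : K) : ‖U v‖ = ‖v‖ := U.norm_map_of_mem_unitary hU v
  have hUpow (n : ℕ) (v : K) : ‖(U ^ n) v‖ = ‖v‖ :=
    ContinuousLinearMap.norm_map_of_mem_unitary (pow_mem hU n) v
  have hPJ (v : H) : P (J v) = v := by
    refine ext_inner_right ℂ fun y => ?_
    rw [hP, ContinuousLinearMap.adjoint_inner_left]
    exact J.inner_map_map v y
  set v : H := x - z • Y x with hv
  have hsum : Summable fun n : ℕ => z ^ n • (U ^ n) (J v) := by
    refine Summable.of_norm_bounded
      ((summable_geometric_of_lt_one (norm_nonneg z) hz).mul_right ‖J v‖) fun n => ?_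
    rw [norm_smul, norm_pow, hUpow]
  obtain ⟨u, hu⟩ := hsum
  have hzU : u - z • U u = J v := by
    have h1 : HasSum (fun n : ℕ => z ^ (n + 1) • (U ^ (n + 1)) (J v)) (z • U u) := by
      convert! (U.hasSum hu).const_smul z using 2 with n
      rw [pow_succ', pow_succ', map_smul, smul_smul]
      rfl
    have h2 : HasSum (fun n : ℕ => z ^ (n + 1) • (U ^ (n + 1)) (J v)) (u - J v) := by
      simpa using (hasSum_nat_add_iff' 1).mpr hu
    rw [h1.unique h2]
    abel
  have hPu : (ρ : ℂ) • (P u - v) = z • Y x := by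
    have h1 : HasSum (fun n : ℕ => z ^ (n + 1) • (Y ^ (n + 1)) v) ((ρ : ℂ) • (P u - v)) := by
      have h2 : HasSum (fun n : ℕ => P (z ^ (n + 1) • (U ^ (n + 1)) (J v))) (P u - v) := by
        simpa [hPJ] using (hasSum_nat_add_iff' 1).mpr (P.hasSum hu)
      convert! h2.const_smul (ρ : ℂ) using 2 with n
      rw [h (n + 1) (by omega) v, map_smul, smul_comm]
    let s (n : ℕ) : H := z ^ (n + 1) • (Y ^ (n + 1)) x
    -- The dilation bounds `‖Yⁿ‖` uniformly in `n ≥ 1`, so the remainder of the telescoping sum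
    -- decays like `‖z‖ⁿ`.
    have hs : Tendsto s atTop (𝓝 0) := by
      have hlim : Tendsto (fun n : ℕ => ‖z‖ ^ (n + 1) * (‖(ρ : ℂ)‖ * (‖P‖ * ‖J x‖))) atTop
          (𝓝 0) := by
        have := ((tendsto_pow_atTop_nhds_zero_of_lt_one (norm_nonneg z) hz).comp
          (tendsto_add_atTop_nat 1)).mul_const (‖(ρ : ℂ)‖ * (‖P‖ * ‖J x‖))
        simpa using this
      refine squeeze_zero_norm (fun n => ?_) hlim
      rw [norm_smul, norm_pow, h (n + 1) (by omega) x, norm_smul]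
      gcongr
      refine (P.le_opNorm _).trans_eq ?_
      rw [hUpow]
    have htel : Tendsto (fun N => ∑ n ∈ Finset.range N, z ^ (n + 1) • (Y ^ (n + 1)) v) atTop
        (𝓝 (s 0)) := by
      have heq (N : ℕ) : ∑ n ∈ Finset.range N, z ^ (n + 1) • (Y ^ (n + 1)) v = s 0 - s N := by
        rw [← Finset.sum_range_sub' s]
        refine Finset.sum_congr rfl fun n _ => ?_
        simp only [s]
        rw [hv, map_sub, smul_sub, map_smul, smul_smul, ← pow_succ z, pow_succ Y (n + 1)]
        rfl
      simp_rw [heq]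
      simpa using tendsto_const_nhds.sub hs
    rw [tendsto_nhds_unique h1.tendsto_sum_nat htel]
    simp [s]
  have hre : 0 ≤ (⟪(2 : ℂ) • u - J v, J v⟫_ℂ).re := by
    rw [← hzU, show (2 : ℂ) • u - (u - z • U u) = u + z • U u by rw [two_smul]; abel]
    have hzu : ‖z • U u‖ ≤ ‖u‖ := by
      rw [norm_smul, hUnorm]
      exact mul_le_of_le_one_left (norm_nonneg u) hz.le
    have hsq : ‖z • U u‖ ^ 2 ≤ ‖u‖ ^ 2 := by gcongr
    have h1 : (⟪u, u⟫_ℂ).re = ‖u‖ ^ 2 := inner_self_eq_norm_sq (𝕜 := ℂ) u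
    have h2 : (⟪z • U u, z • U u⟫_ℂ).re = ‖z • U u‖ ^ 2 := inner_self_eq_norm_sq (𝕜 := ℂ) _
    have h3 : (⟪z • U u, u⟫_ℂ).re = (⟪u, z • U u⟫_ℂ).re := inner_re_symm (𝕜 := ℂ) _ _
    rw [inner_add_left, inner_sub_right, inner_sub_right]
    simp only [Complex.add_re, Complex.sub_re]
    linarith
  have hPu' : P u = v + ((ρ⁻¹ : ℝ) : ℂ) • z • Y x := by
    have hρ' : (ρ : ℂ) ≠ 0 := by exact_mod_cast hρ
    rw [← hPu, smul_smul, Complex.ofReal_inv, inv_mul_cancel₀ hρ', one_smul]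
    abel
  have heq : ⟪(2 : ℂ) • u - J v, J v⟫_ℂ = ⟪x + ((2 * ρ⁻¹ - 1 : ℝ) : ℂ) • z • Y x, v⟫_ℂ := by
    have : ⟪(2 : ℂ) • u - J v, J v⟫_ℂ = ⟪P ((2 : ℂ) • u - J v), v⟫_ℂ := by
      rw [hP, ContinuousLinearMap.adjoint_inner_left]
      rfl
    rw [this, map_sub, map_smul, hPJ, hPu']
    congr 1
    rw [hv]
    push_cast
    module
  rw [heq, hv, inner_add_left, inner_sub_right, inner_sub_right, 
    inner_smul_left (z • Y x), inner_smul_left (z • Y x), Complex.conj_ofReal] at hre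
  have h1 : (⟪x, x⟫_ℂ).re = ‖x‖ ^ 2 := inner_self_eq_norm_sq (𝕜 := ℂ) x
  have h2 : (⟪z • Y x, z • Y x⟫_ℂ).re = ‖z • Y x‖ ^ 2 := inner_self_eq_norm_sq (𝕜 := ℂ) _
  have h3 : (⟪x, z • Y x⟫_ℂ).re = (⟪z • Y x, x⟫_ℂ).re := inner_re_symm (𝕜 := ℂ) _ _
  simp only [Complex.add_re, Complex.sub_re, Complex.re_ofReal_mul, h1, h2, h3] at hre
  rw [beta]
  linarith

/-- The disc inequality extends to `‖z‖ = 1` by radial limits; the phase of `z` is then chosen so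
that `β Re⟪zYx, x⟫ = -|β| |⟪Yx, x⟫|`. -/
theorem IsRhoContraction.inequality {ρ : ℝ} (hρ : ρ ≠ 0) {Y : H →L[ℂ] H}
    (hY : IsRhoContraction ρ Y) (x : H) :
    |beta ρ| * ‖⟪Y x, x⟫_ℂ‖ + (2 * ρ⁻¹ - 1) * ‖Y x‖ ^ 2 ≤ ‖x‖ ^ 2 := by
  have circle (z : ℂ) (hz : ‖z‖ = 1) :
      0 ≤ ‖x‖ ^ 2 + beta ρ * (⟪z • Y x, x⟫_ℂ).re - (2 * ρ⁻¹ - 1) * ‖Y x‖ ^ 2 := by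
    let f (r : ℝ) : ℝ := ‖x‖ ^ 2 + beta ρ * (⟪((r : ℂ) * z) • Y x, x⟫_ℂ).re -
      (2 * ρ⁻¹ - 1) * ‖((r : ℂ) * z) • Y x‖ ^ 2
    have hf : Continuous f := by fun_prop
    have h1 : f 1 = ‖x‖ ^ 2 + beta ρ * (⟪z • Y x, x⟫_ℂ).re - (2 * ρ⁻¹ - 1) * ‖Y x‖ ^ 2 := by
      simp [f, norm_smul, hz]
    rw [← h1]
    refine ge_of_tendsto (hf.continuousWithinAt (s := Set.Iio 1) (x := 1)).tendsto ?_
    filter_upwards [Ioo_mem_nhdsLT (show (0 : ℝ) < 1 by norm_num)] with r hr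
    refine hY.disc_inequality hρ x ?_
    rw [norm_mul, hz, mul_one, Complex.norm_real, Real.norm_of_nonneg hr.1.le]
    exact hr.2
  obtain ⟨c, hc, hcw⟩ := RCLike.exists_norm_eq_mul_self (⟪Y x, x⟫_ℂ)
  have hre (s : ℝ) : (⟪((s : ℂ) * star c) • Y x, x⟫_ℂ).re = s * ‖⟪Y x, x⟫_ℂ‖ := by
    rw [inner_smul_left, map_mul, Complex.conj_ofReal, starRingEnd_apply, star_star, mul_assoc,
      ← hcw, Complex.re_ofReal_mul]
    rfl
  rcases abs_cases (beta ρ) with ⟨h, _⟩ | ⟨h, _⟩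
  · have := circle (((-1 : ℝ) : ℂ) * star c) (by simp [hc])
    rw [hre] at this
    rw [h]
    linarith
  · have := circle (((1 : ℝ) : ℂ) * star c) (by simp [hc])
    rw [hre] at this
    rw [h]
    linarith

/-! ### Numerical radius bounds -/

theorem star_blockOp (S X Y T : H →L[ℂ] H) :
    star (blockOp S X Y T) = blockOp (star S) (star Y) (star X) (star T) := by
  rw [ContinuousLinearMap.star_eq_adjoint, eq_comm, ContinuousLinearMap.eq_adjoint_iff]
  intro z w
  rw [inner_blockOp, ← inner_conj_symm z, inner_blockOp]
  simp only [ContinuousLinearMap.star_eq_adjoint, inner_add_left,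
    ContinuousLinearMap.adjoint_inner_left, map_add, inner_conj_symm]
  ring

theorem rhoRadius_nonneg (ρ : ℝ) (X : H →L[ℂ] H) : 0 ≤ rhoRadius ρ X :=
  Real.sInf_nonneg fun _ ht => ht.1.le

/-- The numerical radius of the operator matrix with rows `0, αX` and `0, βX` is at most the
operator radius `w_ρ(X)`. -/
theorem norm_inner_blockOp_le_rhoRadius {ρ : ℝ} (hρ : ρ ∈ Set.Ioc (0 : ℝ) 2) (X : H →L[ℂ] H)
    {z : Double H} (hz : ‖z‖ = 1) :
    ‖⟪blockOp 0 ((alpha ρ : ℂ) • X) 0 ((beta ρ : ℂ) • X) z, z⟫_ℂ‖ ≤ rhoRadius ρ X := by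
  refine le_csInf (exists_isRhoContraction hρ.1 X) fun t ht => ?_
  obtain ⟨ht, hc⟩ := ht
  set Y := ((t⁻¹ : ℝ) : ℂ) • X with hYdef
  have hX : X = (t : ℂ) • Y := by
    have : (t : ℂ) ≠ 0 := by exact_mod_cast ht.ne'
    rw [hYdef, smul_smul, Complex.ofReal_inv, mul_inv_cancel₀ this, one_smul]
  have hin := hc.inequality hρ.1.ne' z.snd
  -- `ρ ≤ 2` makes the radicand of `α` nonnegative, and `α²/4` is exactly the coefficient of `‖Yx‖²`
  -- in `hin`.
  have ha : alpha ρ ^ 2 = 4 * (2 * ρ⁻¹ - 1) := by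
    have : 1 / 2 ≤ ρ⁻¹ := by
      rw [one_div]
      exact inv_anti₀ hρ.1 hρ.2
    rw [alpha, Real.sq_sqrt (by linarith)]
    ring
  have ha0 : 0 ≤ alpha ρ := Real.sqrt_nonneg _
  have hz2 : ‖z.fst‖ ^ 2 + ‖z.snd‖ ^ 2 = 1 := by
    rw [← WithLp.prod_norm_sq_eq_of_L2, hz, one_pow]
  have hexp : ⟪blockOp 0 ((alpha ρ : ℂ) • X) 0 ((beta ρ : ℂ) • X) z, z⟫_ℂ =
      t * (alpha ρ * ⟪Y z.snd, z.fst⟫_ℂ + beta ρ * ⟪Y z.snd, z.snd⟫_ℂ) := by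
    rw [inner_blockOp, hX]
    simp only [zero_apply, zero_add, smul_apply,
      inner_smul_left, Complex.conj_ofReal]
    ring
  rw [hexp, norm_mul, Complex.norm_real, Real.norm_of_nonneg ht.le]
  refine mul_le_of_le_one_right ht.le ?_
  calc _ ≤ ‖(alpha ρ : ℂ) * ⟪Y z.snd, z.fst⟫_ℂ‖ + ‖(beta ρ : ℂ) * ⟪Y z.snd, z.snd⟫_ℂ‖ :=
        norm_add_le _ _
    _ = alpha ρ * ‖⟪Y z.snd, z.fst⟫_ℂ‖ + |beta ρ| * ‖⟪Y z.snd, z.snd⟫_ℂ‖ := by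
        rw [norm_mul, norm_mul, Complex.norm_real, Complex.norm_real, Real.norm_of_nonneg ha0,
          Real.norm_eq_abs]
    _ ≤ alpha ρ * (‖Y z.snd‖ * ‖z.fst‖) + |beta ρ| * ‖⟪Y z.snd, z.snd⟫_ℂ‖ := by
        gcongr
        exact norm_inner_le_norm _ _
    -- AM-GM: `α‖Yz₂‖‖z₁‖ ≤ ‖z₁‖² + (α²/4)‖Yz₂‖²`; then `hin` and `‖z₁‖² + ‖z₂‖² = 1` conclude.
    _ ≤ 1 := by nlinarith [sq_nonneg (alpha ρ * ‖Y z.snd‖ - 2 * ‖z.fst‖)]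

/-- The left side is at most `(1 + |c|)²t² = t² + 2|c|t² + c²t²`, where `t = |⟪Tz, z⟫|`. The first
term is at most `‖N‖/2` by Cauchy–Schwarz and AM-GM, the second is handled by Buzano applied to `Tz`
and `T*z`, and the third is kept. -/
theorem norm_inner_add_smul_star_sq_le (T : H →L[ℂ] H) (c : ℝ) {z : H} (hz : ‖z‖ = 1) :
    ‖⟪(T + (c : ℂ) • star T) z, z⟫_ℂ‖ ^ 2 ≤
      c ^ 2 * ‖⟪T z, z⟫_ℂ‖ ^ 2 + |c| * ‖⟪(T * T) z, z⟫_ℂ‖ +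
        (|c| + 1) / 2 * ‖T * star T + star T * T‖ := by
  set N := T * star T + star T * T with hN
  set t := ‖⟪T z, z⟫_ℂ‖ with ht
  have hstar (x y : H) : ⟪(star T) x, y⟫_ℂ = ⟪x, T y⟫_ℂ := by
    rw [ContinuousLinearMap.star_eq_adjoint, ContinuousLinearMap.adjoint_inner_left]
  have hstar' (x y : H) : ⟪x, (star T) y⟫_ℂ = ⟪T x, y⟫_ℂ := by
    rw [ContinuousLinearMap.star_eq_adjoint, ContinuousLinearMap.adjoint_inner_right]
  have htri : ‖⟪(T + (c : ℂ) • star T) z, z⟫_ℂ‖ ≤ (1 + |c|) * t := by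
    have : ⟪(T + (c : ℂ) • star T) z, z⟫_ℂ = ⟪T z, z⟫_ℂ + c * ⟪z, T z⟫_ℂ := by
      rw [add_apply, smul_apply, inner_add_left,
        inner_smul_left, hstar, Complex.conj_ofReal]
    rw [this]
    refine (norm_add_le _ _).trans_eq ?_
    rw [norm_mul, Complex.norm_real, norm_inner_symm z, Real.norm_eq_abs]
    ring
  have hsum : ‖T z‖ ^ 2 + ‖(star T) z‖ ^ 2 ≤ ‖N‖ := by
    have h1 : (⟪N z, z⟫_ℂ).re = ‖(star T) z‖ ^ 2 + ‖T z‖ ^ 2 := by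
      have : ⟪N z, z⟫_ℂ = ⟪(star T) z, (star T) z⟫_ℂ + ⟪T z, T z⟫_ℂ := by
        rw [hN, add_apply, inner_add_left]
        congr 1
        · exact (hstar' _ _).symm
        · exact hstar _ _
      rw [this, Complex.add_re]
      congr 1
      · exact inner_self_eq_norm_sq (𝕜 := ℂ) _
      · exact inner_self_eq_norm_sq (𝕜 := ℂ) _
    have h2 : (⟪N z, z⟫_ℂ).re ≤ ‖N‖ := by
      refine (Complex.re_le_norm _).trans ((norm_inner_le_norm _ _).trans ?_)
      rw [hz, mul_one]
      exact N.unit_le_opNorm z hz.le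
    linarith
  have hbuz : t ^ 2 ≤ (‖T z‖ * ‖(star T) z‖ + ‖⟪(T * T) z, z⟫_ℂ‖) / 2 := by
    have := norm_inner_mul_inner_le hz (T z) ((star T) z)
    rw [hstar', hstar'] at this
    rw [sq]
    exact this
  have hprod : t ^ 2 ≤ ‖T z‖ * ‖(star T) z‖ := by
    have h1 : t ≤ ‖T z‖ := by
      simpa [hz] using norm_inner_le_norm (𝕜 := ℂ) (T z) z
    have h2 : t ≤ ‖(star T) z‖ := by
      rw [ht, ← hstar']
      simpa [hz] using norm_inner_le_norm (𝕜 := ℂ) z ((star T) z)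
    rw [sq]
    exact mul_le_mul h1 h2 (norm_nonneg _) (norm_nonneg _)
  have hamgm : ‖T z‖ * ‖(star T) z‖ ≤ ‖N‖ / 2 := by
    nlinarith [sq_nonneg (‖T z‖ - ‖(star T) z‖)]
  have hmain : |c| * (2 * t ^ 2) ≤ |c| * (‖N‖ / 2 + ‖⟪(T * T) z, z⟫_ℂ‖) := by
    gcongr
    linarith
  calc _ ≤ ((1 + |c|) * t) ^ 2 := by gcongr
    _ = t ^ 2 + |c| * (2 * t ^ 2) + c ^ 2 * t ^ 2 := by rw [← sq_abs c]; ring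
    _ ≤ _ := by linarith

end OperatorRadius

end

/-! ### The main inequality -/

open OperatorRadius

theorem corollary2p12 {H : Type*} [NormedAddCommGroup H] [InnerProductSpace ℂ H] [CompleteSpace H]
    (ρ ν : ℝ) (hρ : ρ ∈ Set.Ioc (0 : ℝ) 2) (hν : ν ∈ Set.Icc (0 : ℝ) 1) (X : H →L[ℂ] H) :
    OperatorRadius.Delta ρ ν X ^ 2 ≤
      (1 - 2 * ν) ^ 2 * OperatorRadius.rhoRadius ρ X ^ 2 +
        |(1 - 2 * ν) * OperatorRadius.beta ρ| * OperatorRadius.rhoRadius ρ (X ^ 2) +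
        (|1 - 2 * ν| + 1) / 2 *
          ‖OperatorRadius.blockOp (OperatorRadius.blockA ρ X) (OperatorRadius.blockB ρ X)
            (OperatorRadius.blockB ρ X) (OperatorRadius.blockC ρ X)‖ := by
  set c : ℝ := 1 - 2 * ν with hc
  set T := blockOp 0 ((alpha ρ : ℂ) • X) 0 ((beta ρ : ℂ) • X) with hT
  have hstarT : star T =
      blockOp 0 0 ((alpha ρ : ℂ) • star X) ((beta ρ : ℂ) • star X) := by
    rw [hT, star_blockOp]
    simp only [star_zero, star_smul, Complex.star_def, Complex.conj_ofReal]
  have hM : blockOp 0 ((alpha ρ : ℂ) • X) (((alpha ρ * c : ℝ) : ℂ) • star X)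
      ((beta ρ : ℂ) • (X + (c : ℂ) • star X)) = T + (c : ℂ) • star T := by
    rw [hstarT, hT, smul_blockOp, blockOp_add]
    congr 1
    · simp
    · simp
    · push_cast
      module
    · module
  have hN : T * star T + star T * T =
      blockOp (blockA ρ X) (blockB ρ X) (blockB ρ X) (blockC ρ X) := by
    rw [hstarT, hT, blockA, blockB, blockC, CFC.abs_sq, CFC.abs_sq, star_star, blockOp_mul, blockOp_mul,
      blockOp_add]
    simp only [smul_mul_smul_comm, zero_mul, mul_zero, zero_add, add_zero]
    congr 1
    · push_cast
      module
    · push_cast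
      module
    · push_cast
      module
    · push_cast
      module
  have hTT : T * T =
      (beta ρ : ℂ) • blockOp 0 ((alpha ρ : ℂ) • X ^ 2) 0 ((beta ρ : ℂ) • X ^ 2) := by
    rw [hT, blockOp_mul, smul_blockOp]
    simp only [smul_mul_smul_comm, zero_mul, mul_zero, zero_add, ← sq X]
    congr 1 <;> module
  have hR : 0 ≤ c ^ 2 * rhoRadius ρ X ^ 2 + |c * beta ρ| * rhoRadius ρ (X ^ 2) +
      (|c| + 1) / 2 * ‖blockOp (blockA ρ X) (blockB ρ X) (blockB ρ X) (blockC ρ X)‖ := by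
    have := rhoRadius_nonneg ρ (X ^ 2)
    positivity
  have hD : Delta ρ ν X ≤ √(c ^ 2 * rhoRadius ρ X ^ 2 + |c * beta ρ| * rhoRadius ρ (X ^ 2) +
      (|c| + 1) / 2 * ‖blockOp (blockA ρ X) (blockB ρ X) (blockB ρ X) (blockC ρ X)‖) := by
    -- Nonnegativity of the bound covers the zero space, where there are no unit vectors and the
    -- supremum is `0` by convention.
    refine Real.sSup_le ?_ (Real.sqrt_nonneg _)
    rintro _ ⟨z, hz, rfl⟩
    refine Real.le_sqrt_of_sq_le ?_
    rw [← hc, hM, ← hN]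
    refine (norm_inner_add_smul_star_sq_le T c hz).trans ?_
    have h1 := norm_inner_blockOp_le_rhoRadius hρ X hz
    have h2 := norm_inner_blockOp_le_rhoRadius hρ (X ^ 2) hz
    rw [← hT] at h1
    have h3 : |c| * ‖⟪(T * T) z, z⟫_ℂ‖ ≤ |c * beta ρ| * rhoRadius ρ (X ^ 2) := by
      rw [hTT, smul_apply, inner_smul_left, norm_mul, Complex.conj_ofReal,
        Complex.norm_real, Real.norm_eq_abs, ← mul_assoc, ← abs_mul]
      gcongr
    gcongr
  have hD0 : 0 ≤ Delta ρ ν X := by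
    refine Real.sSup_nonneg ?_
    rintro _ ⟨z, hz, rfl⟩
    exact norm_nonneg _
  calc Delta ρ ν X ^ 2 ≤ _ := pow_le_pow_left₀ hD0 hD 2
    _ = _ := Real.sq_sqrt hR
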